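/- Let $\mathbb D$ be the open unit disc. Let $E\subset\mathbb D$ be relatively closed in $\mathbb D$ and non-Blaschke, i.e. $E$ contains a sequence of distinct points $(z_j)$ with $\sum_j(1-|z_j|)=\infty$. Let $q$ be holomorphic and zero-free on $\mathbb D$ with $\sup_{\mathbb D}|q|=1$ and $q(z)\to0$ as $z\in E$, $|z|\to1$ (an empty condition if $\overline E\subset\mathbb D$). For a finite tuple $Z_n=(z_1,\dots,z_n)$ of points of $\mathbb D$ put $$B_q(Z_n,z)=q(z)\prod_{j=1}^n\frac{z-z_j}{1-\overline{z_j}z},\qquad V(Z_n)=\prod_{j=1}^n|B_q((z_1,\dots,z_{j-1}),z_j)|,$$ $$M(Z_n)=\sup_{z\in E}|B_q(Z_n,z)|,\qquad V_n(E)=\sup_{Z_n\in E^n}V(Z_n),\qquad M_n(E)=\inf\{M(Z_n):Z_n\in E^n,\ V(Z_n)=V_n(E)\}.$$ For $1\le p\le\infty$, $0<R<1$ and $\epsilon>0$ let $$C_p(E,\epsilon,R)=\sup\Big\{\sup_{|z|\le R}|f(z)|:\ f\in H^p(\mathbb D),\ \|f\|_{H^p}=1,\ |f|\le\epsilon\text{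 on }E\Big\},$$ $$g(E,\epsilon,R,q)=\sup\Big\{\sup_{|z|\le R}|B_q(Z_n,z)|:\ n\ge0,\ Z_n\in E^n,\ |B_q(Z_n,\cdot)|\le\epsilon\text{ on }E\Big\}.$$ **Corollary.** There are constants $\kappa>0$ depending only on $\sigma$, $\alpha>0$ depending only on $R$, $K>0$ depending only on $p$ and $R$, and $\epsilon_0>0$ depending only on $E$ and $q$, such that the following holds. If, for some $C>0$, $\sigma>0$ and integer $N>0$, we have $M_n(E)\le Cn^{-\sigma}$ for all $n\ge N$, then for all $1\le p\le\infty$, $0<R<1$ and $0<\epsilon<\epsilon_0$, $$g(E,\epsilon,R,q)\le C_p(E,\epsilon,R)\le K\,|q(0)|^{-\alpha}\,g(E,\epsilon^{\kappa},R,q)^{\alpha}.$$ -/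

import Mathlib

open Set Filter Topology MeasureTheory
open scoped ENNReal ComplexConjugate

namespace HardyStability

noncomputable section

/-- The open unit disc of the complex plane. -/
def disc : Set ℂ := Metric.ball 0 1

/-- The normalized Lebesgue measure `dθ / 2π` on `(0, 2π]`. -/
def angleMeasure : Measure ℝ :=
  (ENNReal.ofReal (2 * Real.pi))⁻¹ • volume.restrict (Ioc 0 (2 * Real.pi))

/-- The `p`-th mean of `f` over the circle of radius `r`, that is
`((1 / 2π) ∫ |f (r e^{iθ})|^p dθ)^{1/p}` for `p < ∞`, and the (essential) supremum over `θ`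
of `|f (r e^{iθ})|` for `p = ∞`. -/
def circleMean (p : ℝ≥0∞) (f : ℂ → ℂ) (r : ℝ) : ℝ≥0∞ :=
  eLpNorm (fun θ : ℝ => f (circleMap 0 r θ)) p angleMeasure

/-- The Hardy norm of `f`: the limit of the circle means as `r` increases to `1`. For `f`
holomorphic on the disc the means are nondecreasing in `r`, so the limit exists in `[0, ∞]` and
is the `limsup`. -/
def hardyNorm (p : ℝ≥0∞) (f : ℂ → ℂ) : ℝ≥0∞ :=
  limsup (circleMean p f) (𝓝[<] (1 : ℝ))

/-- The Hardy space `H^p` of the disc. Only the values of `f` on the disc matter. -/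
def hardySpace (p : ℝ≥0∞) : Set (ℂ → ℂ) :=
  {f | DifferentiableOn ℂ f disc ∧ hardyNorm p f < ∞}

/-- The class of functions of norm exactly one in `H^p`. -/
def hardySphere (p : ℝ≥0∞) : Set (ℂ → ℂ) :=
  {f | f ∈ hardySpace p ∧ hardyNorm p f = 1}

/-- The stability modulus `C_p(E, ε, R)`: the supremum of `sup_{|z| ≤ R} |f z|` over all `f` of
norm one in `H^p` with `|f| ≤ ε` on `E`. -/
def stabilityModulus (p : ℝ≥0∞) (E : Set ℂ) (ε R : ℝ) : ℝ≥0∞ :=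
  ⨆ f ∈ {f : ℂ → ℂ | f ∈ hardySphere p ∧ ∀ ζ ∈ E, ‖f ζ‖ ≤ ε},
    ⨆ z ∈ {z : ℂ | ‖z‖ ≤ R}, ‖f z‖ₑ

/-- The finite Blaschke product with zeros `Z 0, …, Z (n - 1)`. -/
def blaschke {n : ℕ} (Z : Fin n → ℂ) (z : ℂ) : ℂ :=
  ∏ j, (z - Z j) / (1 - conj (Z j) * z)

/-- The weighted Blaschke product `B_q(Z, z) = q(z) B(Z, z)`. -/
def wBlaschke (q : ℂ → ℂ) {n : ℕ} (Z : Fin n → ℂ) (z : ℂ) : ℂ :=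
  q z * blaschke Z z

/-- `g(E, ε, R, q)`: the supremum of `sup_{|z| ≤ R} |B_q(Z, z)|` over all finite tuples `Z` of
points of `E` with `|B_q(Z, ·)| ≤ ε` on `E`. -/
def blaschkeModulus (E : Set ℂ) (ε R : ℝ) (q : ℂ → ℂ) : ℝ≥0∞ :=
  ⨆ (n : ℕ) (Z ∈ {Z : Fin n → ℂ | (∀ j, Z j ∈ E) ∧ ∀ ζ ∈ E, ‖wBlaschke q Z ζ‖ ≤ ε}),
    ⨆ z ∈ {z : ℂ | ‖z‖ ≤ R}, ‖wBlaschke q Z z‖ₑ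

/-- `V(z₁, …, zₙ) = ∏ⱼ |B_q((z₁, …, zⱼ₋₁), zⱼ)|`. -/
def feketeProduct (q : ℂ → ℂ) {n : ℕ} (Z : Fin n → ℂ) : ℝ≥0∞ :=
  ∏ j : Fin n, ‖wBlaschke q (fun i : Fin (j : ℕ) => Z (Fin.castLE j.isLt.le i)) (Z j)‖ₑ

/-- `Vₙ(E)`: the supremum of `V` over the `n`-tuples of points of `E`. -/
def feketeSup (E : Set ℂ) (q : ℂ → ℂ) (n : ℕ) : ℝ≥0∞ :=
  ⨆ Z ∈ {Z : Fin n → ℂ | ∀ j, Z j ∈ E}, feketeProduct q Z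

/-- `M(Z) = sup_{z ∈ E} |B_q(Z, z)|`. -/
def supOn (E : Set ℂ) (q : ℂ → ℂ) {n : ℕ} (Z : Fin n → ℂ) : ℝ≥0∞ :=
  ⨆ z ∈ E, ‖wBlaschke q Z z‖ₑ

/-- `Mₙ(E)`: the infimum of `M(Z)` over the `n`-tuples `Z` of points of `E` that attain
`Vₙ(E)`. -/
def feketeM (E : Set ℂ) (q : ℂ → ℂ) (n : ℕ) : ℝ≥0∞ :=
  ⨅ Z ∈ {Z : Fin n → ℂ | (∀ j, Z j ∈ E) ∧ feketeProduct q Z = feketeSup E q n}, supOn E q Z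

/-- `E` is a relatively closed subset of the unit disc. -/
def IsRelClosed (E : Set ℂ) : Prop := closure E ∩ disc = E

/-- `E` contains a sequence of distinct points with `∑ (1 - |zⱼ|) = ∞`. -/
def IsNonBlaschke (E : Set ℂ) : Prop :=
  ∃ z : ℕ → ℂ, Function.Injective z ∧ (∀ j, z j ∈ E) ∧ ¬ Summable fun j => 1 - ‖z j‖

/-- `q` is an admissible weight for `E`: holomorphic and zero-free on the disc, with supremum norm
one, and `q(z) → 0` as `z ∈ E` tends to the unit circle (an empty condition if `E` stays away
from the circle; then `q = 1` is allowed). -/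
structure IsWeight (E : Set ℂ) (q : ℂ → ℂ) : Prop where
  holo : DifferentiableOn ℂ q disc
  ne_zero : ∀ z ∈ disc, q z ≠ 0
  sup_eq_one : ⨆ z ∈ disc, ‖q z‖ₑ = 1
  tendsto_zero : Tendsto q (comap (fun z : ℂ => ‖z‖) (𝓝 1) ⊓ 𝓟 E) (𝓝 0)

end

end HardyStability

/-! Upper bound. Choose a tuple of n points of E maximizing V, and let W_j be its weighted Blaschke
product with z_j left out. Since V is symmetric, |W_j(z_j)| ≥ V_n / V_{n-1}, and appending a point
gives V_n ≥ M_{n-1} V_{n-1}. Take n to be the first index from N on with M_n < δ = ε^κ. If n > N,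
then M_{n-1} ≥ δ, so the nodes are δ-separated in this sense, while polynomial decay bounds n by a
multiple of δ^{-1/σ}; hence nε ≤ δ for small ε. Subtracting from f the Lagrange interpolant Σ f(z_j)
W_j / W_j(z_j), of norm at most nε/δ ≤ 1, leaves a function that is divisible by the Blaschke
product of the tuple (`norm_le_of_interpolation`). Thus on |z| ≤ R, f is controlled by (∏ max(R,
|z_j|))^α, up to a constant. By the maximum principle |q(0)| ∏ max(R, |z_j|) is at most the supremum
of |B_q| over |z| ≤ R (`norm_zero_mul_prod_le`), hence at most g(E, δ, R, q).

Lower bound. A product B_q competing in g has norm at most one, but the norm must equal one. A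
multiple of another product, tiny on E, is added with a suitable phase until the norm reaches one
(`blaschkeModulus_le_stabilityModulus`).

Uniformity. To keep ε₀ independent of σ, a single rate σ₀ is fixed that dominates min(σ/2, 1) for
every admissible σ. -/

namespace HardyStability

/-! ### Estimates for a single Blaschke factor -/

/-- The Blaschke factor of the disc with zero `a`. -/
noncomputable def factor (a z : ℂ) : ℂ := (z - a) / (1 - conj a * z)

theorem mem_disc {z : ℂ} : z ∈ disc ↔ ‖z‖ < 1 := by simp [disc]

theorem isOpen_disc : IsOpen disc := Metric.isOpen_ball

theorem norm_conj_mul_lt_one {a z : ℂ} (ha : ‖a‖ < 1) (hz : ‖z‖ ≤ 1) : ‖conj a * z‖ < 1 := by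
  rw [norm_mul, RCLike.norm_conj]
  nlinarith [norm_nonneg a, norm_nonneg z]

theorem one_sub_conj_mul_ne_zero {a z : ℂ} (ha : ‖a‖ < 1) (hz : ‖z‖ ≤ 1) :
    1 - conj a * z ≠ 0 := by
  intro h
  have h1 := norm_conj_mul_lt_one ha hz
  rw [← sub_eq_zero.mp h, norm_one] at h1
  exact lt_irrefl _ h1

/-- Dividing by the left side computes 1 - |`factor a z`|²; the modulus bounds on a factor below all
rest on this. -/
theorem sq_norm_one_sub_conj_mul (a z : ℂ) :
    ‖1 - conj a * z‖ ^ 2 = ‖z - a‖ ^ 2 + (1 - ‖a‖ ^ 2) * (1 - ‖z‖ ^ 2) := by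
  simp only [Complex.sq_norm, Complex.normSq_apply, Complex.sub_re, Complex.sub_im,
    Complex.mul_re, Complex.mul_im, Complex.conj_re, Complex.conj_im, Complex.one_re,
    Complex.one_im]
  ring

theorem norm_one_sub_conj_mul_pos {a z : ℂ} (ha : ‖a‖ < 1) (hz : ‖z‖ ≤ 1) :
    0 < ‖1 - conj a * z‖ :=
  norm_pos_iff.mpr (one_sub_conj_mul_ne_zero ha hz)

theorem norm_factor_le_one {a z : ℂ} (ha : ‖a‖ < 1) (hz : ‖z‖ ≤ 1) : ‖factor a z‖ ≤ 1 := by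
  have h := norm_one_sub_conj_mul_pos ha hz
  rw [factor, norm_div, div_le_one h]
  refine le_of_sq_le_sq ?_ h.le
  rw [sq_norm_one_sub_conj_mul]
  have : 0 ≤ (1 - ‖a‖ ^ 2) * (1 - ‖z‖ ^ 2) := by
    apply mul_nonneg <;> nlinarith [norm_nonneg a, norm_nonneg z]
  linarith

theorem norm_factor_comm (a z : ℂ) : ‖factor a z‖ = ‖factor z a‖ := by
  rw [factor, factor, norm_div, norm_div, norm_sub_rev]
  congr 1
  rw [← RCLike.norm_conj]
  simp [mul_comm]

theorem factor_ne_zero {a z : ℂ} (ha : ‖a‖ < 1) (hz : ‖z‖ ≤ 1) (h : z ≠ a) : factor a z ≠ 0 :=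
  div_ne_zero (sub_ne_zero.mpr h) (one_sub_conj_mul_ne_zero ha hz)

theorem factor_self (a : ℂ) : factor a a = 0 := by simp [factor]

theorem norm_factor_zero (a : ℂ) : ‖factor a 0‖ = ‖a‖ := by simp [factor]

theorem differentiableOn_factor {a : ℂ} (ha : ‖a‖ < 1) : DifferentiableOn ℂ (factor a) disc := by
  intro z hz
  apply DifferentiableAt.differentiableWithinAt
  unfold factor
  exact DifferentiableAt.div (by fun_prop) (by fun_prop)
    (one_sub_conj_mul_ne_zero ha (mem_disc.mp hz).le)

/-- The Blaschke factor is close to unimodular near the unit circle. -/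
theorem le_norm_factor {a z : ℂ} (ha : ‖a‖ < 1) (hz : ‖z‖ < 1) :
    (‖z‖ - ‖a‖) / (1 - ‖a‖ * ‖z‖) ≤ ‖factor a z‖ := by
  have h0 := norm_nonneg a
  have h1 := norm_nonneg z
  have hd : 0 < 1 - ‖a‖ * ‖z‖ := by nlinarith
  have h := norm_one_sub_conj_mul_pos ha hz.le
  by_cases hza : ‖z‖ < ‖a‖
  · exact (div_nonpos_of_nonpos_of_nonneg (by linarith) hd.le).trans (norm_nonneg _)
  push Not at hza
  -- For fixed ‖a‖ and ‖z‖ the squared modulus is 1 - const / ‖1 - āz‖², smallest when the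
  -- denominator is smallest.
  have hlow : 1 - ‖a‖ * ‖z‖ ≤ ‖1 - conj a * z‖ := by
    have := norm_sub_norm_le (1 : ℂ) (conj a * z)
    rwa [norm_one, norm_mul, RCLike.norm_conj] at this
  rw [factor, norm_div, div_le_div_iff₀ hd h]
  refine le_of_sq_le_sq ?_ (by positivity)
  have key := sq_norm_one_sub_conj_mul a z
  have hsq : (1 - ‖a‖ * ‖z‖) ^ 2 ≤ ‖1 - conj a * z‖ ^ 2 := by gcongr
  have hc : 0 ≤ (1 - ‖a‖ ^ 2) * (1 - ‖z‖ ^ 2) := by apply mul_nonneg <;> nlinarith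
  rw [mul_pow, mul_pow]
  have e : ‖z - a‖ ^ 2 = ‖1 - conj a * z‖ ^ 2 - (1 - ‖a‖ ^ 2) * (1 - ‖z‖ ^ 2) := by linarith
  rw [e]
  nlinarith [mul_le_mul_of_nonneg_left hsq hc]

/-- The exponent comparing the supremum of a Blaschke product over a disc of radius `R` with the
geometric mean of its modulus over the circle of radius `R`. -/
noncomputable def exponent (R : ℝ) : ℝ := R ^ 2 * (1 - R) / (1 + R)

theorem exponent_pos {R : ℝ} (h0 : 0 < R) (h1 : R < 1) : 0 < exponent R := by
  have : 0 < 1 - R := by linarith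
  unfold exponent
  positivity

/-- With m = max(R, |a|), the squared modulus is at most 1 - x ≤ e^{-x} for x = (1 - m²)(1 - R)/(1 +
R). Since -log m² ≤ (1 - m²)/R², this exponential is at most m^{2α} with α = `exponent R`. -/
theorem norm_factor_le_rpow {R : ℝ} (h0 : 0 < R) (h1 : R < 1) {a z : ℂ} (ha : ‖a‖ < 1)
    (hz : ‖z‖ ≤ R) : ‖factor a z‖ ≤ max R ‖a‖ ^ exponent R := by
  set m := max R ‖a‖ with hm
  have hmR : R ≤ m := le_max_left _ _
  have hma : ‖a‖ ≤ m := le_max_right _ _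
  have hm0 : 0 < m := h0.trans_le hmR
  have hm1 : m < 1 := max_lt h1 ha
  have hz1 : ‖z‖ ≤ 1 := hz.trans h1.le
  have hden := norm_one_sub_conj_mul_pos ha hz1
  have hup : ‖1 - conj a * z‖ ≤ 1 + R := by
    refine (norm_sub_le _ _).trans ?_
    rw [norm_one, norm_mul, RCLike.norm_conj]
    nlinarith [norm_nonneg a, norm_nonneg z]
  have hsq : ‖factor a z‖ ^ 2 ≤ 1 - (1 - m ^ 2) * ((1 - R) / (1 + R)) := by
    have e : ‖factor a z‖ ^ 2 =
        1 - (1 - ‖a‖ ^ 2) * (1 - ‖z‖ ^ 2) / ‖1 - conj a * z‖ ^ 2 := by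
      have hne : ‖1 - conj a * z‖ ^ 2 ≠ 0 := by positivity
      rw [factor, norm_div, div_pow, div_eq_iff hne, sub_mul, div_mul_cancel₀ _ hne]
      linarith [sq_norm_one_sub_conj_mul a z]
    rw [e]
    have hq : (1 - m ^ 2) * ((1 - R) / (1 + R)) = (1 - m ^ 2) * (1 - R ^ 2) / (1 + R) ^ 2 := by
      field_simp
      ring
    rw [hq]
    have hz2 : ‖z‖ ^ 2 ≤ R ^ 2 := by gcongr
    have ha2 : ‖a‖ ^ 2 ≤ m ^ 2 := by gcongr
    have : (1 - m ^ 2) * (1 - R ^ 2) / (1 + R) ^ 2 ≤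
        (1 - ‖a‖ ^ 2) * (1 - ‖z‖ ^ 2) / ‖1 - conj a * z‖ ^ 2 := by
      have hR2 : 0 ≤ 1 - R ^ 2 := by nlinarith
      have hm2 : 0 ≤ 1 - m ^ 2 := by nlinarith
      have h1' : 0 ≤ 1 - ‖a‖ ^ 2 := by linarith
      have h2' : 0 ≤ (1 - ‖a‖ ^ 2) * (1 - ‖z‖ ^ 2) := mul_nonneg h1' (by linarith)
      gcongr
    linarith
  have hexp : ‖factor a z‖ ^ 2 ≤ (m ^ exponent R) ^ 2 := by
    have hlog : -Real.log (m ^ 2) ≤ (1 - m ^ 2) / R ^ 2 := by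
      have := Real.log_le_sub_one_of_pos (x := (m ^ 2)⁻¹) (by positivity)
      rw [Real.log_inv] at this
      refine this.trans ?_
      have e : (m ^ 2)⁻¹ - 1 = (1 - m ^ 2) / m ^ 2 := by field_simp
      rw [e]
      have hm2 : 0 ≤ 1 - m ^ 2 := by nlinarith
      gcongr
    rw [← Real.rpow_natCast (m ^ exponent R), ← Real.rpow_mul hm0.le, mul_comm, Real.rpow_mul hm0.le,
      Real.rpow_natCast, Real.rpow_def_of_pos (by positivity)]
    refine hsq.trans ((le_trans (by linarith) (Real.add_one_le_exp
      (-((1 - m ^ 2) * ((1 - R) / (1 + R)))))).trans (Real.exp_le_exp.mpr ?_))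
    have hR1 : 0 < 1 - R := by linarith
    have e : (1 - m ^ 2) * ((1 - R) / (1 + R)) = (1 - m ^ 2) / R ^ 2 * exponent R := by
      unfold exponent
      field_simp
    rw [e]
    nlinarith [mul_le_mul_of_nonneg_right hlog (exponent_pos h0 h1).le]
  exact le_of_sq_le_sq hexp (by positivity)

/-! ### Finite Blaschke products -/

theorem blaschke_eq_prod {n : ℕ} (Z : Fin n → ℂ) (z : ℂ) : blaschke Z z = ∏ j, factor (Z j) z :=
  rfl

theorem differentiableOn_blaschke {n : ℕ} {Z : Fin n → ℂ} (hZ : ∀ j, ‖Z j‖ < 1) :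
    DifferentiableOn ℂ (blaschke Z) disc := by
  have : blaschke Z = fun z => ∏ j, factor (Z j) z := rfl
  rw [this]
  exact DifferentiableOn.fun_finsetProd fun j _ => differentiableOn_factor (hZ j)

theorem norm_blaschke_le_one {n : ℕ} {Z : Fin n → ℂ} (hZ : ∀ j, ‖Z j‖ < 1) {z : ℂ}
    (hz : ‖z‖ ≤ 1) : ‖blaschke Z z‖ ≤ 1 := by
  rw [blaschke_eq_prod, norm_prod]
  exact Finset.prod_le_one (fun _ _ => norm_nonneg _) fun j _ => norm_factor_le_one (hZ j) hz

theorem norm_blaschke_le_rpow {R : ℝ} (h0 : 0 < R) (h1 : R < 1) {n : ℕ} {Z : Fin n → ℂ}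
    (hZ : ∀ j, ‖Z j‖ < 1) {z : ℂ} (hz : ‖z‖ ≤ R) :
    ‖blaschke Z z‖ ≤ (∏ j, max R ‖Z j‖) ^ exponent R := by
  rw [blaschke_eq_prod, norm_prod,
    ← Real.finsetProd_rpow _ _ fun j _ => h0.le.trans (le_max_left _ _)]
  exact Finset.prod_le_prod (fun _ _ => norm_nonneg _) fun j _ =>
    norm_factor_le_rpow h0 h1 (hZ j) hz

/-- A Blaschke product is close to unimodular near the unit circle. -/
theorem eventually_le_norm_blaschke {n : ℕ} {Z : Fin n → ℂ} (hZ : ∀ j, ‖Z j‖ < 1) {c : ℝ}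
    (hc : c < 1) : ∀ᶠ r in 𝓝[<] (1 : ℝ), ∀ z : ℂ, ‖z‖ = r → c ≤ ‖blaschke Z z‖ := by
  have ht : Tendsto (fun r : ℝ => ∏ j, (r - ‖Z j‖) / (1 - ‖Z j‖ * r)) (𝓝[<] 1) (𝓝 1) := by
    have : ContinuousAt (fun r : ℝ => ∏ j, (r - ‖Z j‖) / (1 - ‖Z j‖ * r)) 1 := by
      refine tendsto_finsetProd _ fun j _ => ?_
      refine ContinuousAt.div (f := fun r : ℝ => r - ‖Z j‖) (by fun_prop) (by fun_prop) ?_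
      have := hZ j
      rw [mul_one]
      exact (by linarith : (0 : ℝ) < 1 - ‖Z j‖).ne'
    have h := this.tendsto
    have e : ∏ j, ((1 : ℝ) - ‖Z j‖) / (1 - ‖Z j‖ * 1) = 1 := by
      refine Finset.prod_eq_one fun j _ => ?_
      have := hZ j
      rw [mul_one, div_self (by linarith : (0 : ℝ) < 1 - ‖Z j‖).ne']
    rw [e] at h
    exact h.mono_left nhdsWithin_le_nhds
  have hge : ∀ᶠ r in 𝓝[<] (1 : ℝ), ∀ j, ‖Z j‖ ≤ r :=
    eventually_all.mpr fun j =>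
      (eventually_ge_nhds (hZ j)).filter_mono nhdsWithin_le_nhds
  filter_upwards [ht.eventually_const_le hc, hge, self_mem_nhdsWithin] with r hr hj hr1 z hz
  refine hr.trans ?_
  rw [blaschke_eq_prod, norm_prod]
  refine Finset.prod_le_prod (fun j _ => ?_) fun j _ => ?_
  · have h1 := hZ j
    have h2 := hj j
    have h3 : r < 1 := hr1
    exact div_nonneg (by linarith) (by nlinarith [norm_nonneg (Z j)])
  · rw [← hz]
    exact le_norm_factor (hZ j) (hz ▸ hr1)

/-- The maximum of a weighted Blaschke product over the closed disc of radius `R` is at least its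
geometric mean over the circle of radius `R`. -/
theorem norm_zero_mul_prod_le {q : ℂ → ℂ} (hq : DifferentiableOn ℂ q disc) {R : ℝ} (h0 : 0 < R)
    (h1 : R < 1) {n : ℕ} {Z : Fin n → ℂ} (hZ : ∀ j, ‖Z j‖ < 1) {M : ℝ}
    (hM : ∀ z : ℂ, ‖z‖ ≤ R → ‖wBlaschke q Z z‖ ≤ M) :
    ‖q 0‖ * ∏ j, max R ‖Z j‖ ≤ M := by
  -- A factor with |Z_j| < R is replaced by a function of the same modulus on |z| = R and of modulus
  -- R at 0. So |G| = |B_q| on the circle, while each factor contributes max(R, |Z_j|) to |G(0)|.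
  let G : ℂ → ℂ := fun z => q z *
    ∏ j, if R ≤ ‖Z j‖ then factor (Z j) z else (R ^ 2 - conj (Z j) * z) / (R * (1 - conj (Z j) * z))
  have hG0 : ‖G 0‖ = ‖q 0‖ * ∏ j, max R ‖Z j‖ := by
    simp only [G, norm_mul, norm_prod]
    congr 1
    refine Finset.prod_congr rfl fun j _ => ?_
    split_ifs with h
    · rw [norm_factor_zero, max_eq_right h]
    · rw [max_eq_left (not_le.mp h).le]
      simp [abs_of_pos h0]
      field_simp
  have hR0 : (R : ℂ) ≠ 0 := by exact_mod_cast h0.ne'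
  have hd : DifferentiableOn ℂ G disc := by
    refine hq.mul (DifferentiableOn.fun_finsetProd fun j _ => ?_)
    split_ifs with h
    · exact differentiableOn_factor (hZ j)
    · intro z hz
      refine DifferentiableAt.differentiableWithinAt (DifferentiableAt.div (by fun_prop)
        (by fun_prop) ?_)
      exact mul_ne_zero hR0 (one_sub_conj_mul_ne_zero (hZ j) (mem_disc.mp hz).le)
  have hsub : Metric.closedBall (0 : ℂ) R ⊆ disc := Metric.closedBall_subset_ball h1
  have hcl : DiffContOnCl ℂ G (Metric.ball 0 R) :=
    (hd.mono hsub).diffContOnCl_ball subset_rfl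
  rw [← hG0]
  refine Complex.norm_le_of_forall_mem_frontier_norm_le Metric.isBounded_ball hcl (fun z hz => ?_)
    (subset_closure (Metric.mem_ball_self h0))
  rw [frontier_ball _ h0.ne', mem_sphere_zero_iff_norm] at hz
  have hz1 : ‖z‖ ≤ 1 := hz.le.trans h1.le
  refine le_trans (le_of_eq ?_) (hM z hz.le)
  simp only [G, wBlaschke, blaschke_eq_prod, norm_mul, norm_prod]
  congr 1
  refine Finset.prod_congr rfl fun j _ => ?_
  split_ifs with h
  · rfl
  · rw [factor, norm_div, norm_div, norm_mul, ← div_div]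
    congr 1
    rw [Complex.norm_real, Real.norm_of_nonneg h0.le, div_eq_iff h0.ne']
    have e : (R : ℂ) ^ 2 - conj (Z j) * z = conj (z - Z j) * z := by
      have := Complex.conj_mul' z
      rw [hz] at this
      rw [map_sub, sub_mul, this]
    rw [e, norm_mul, RCLike.norm_conj, hz]

/-! ### Hardy norms, point evaluation and division by zeros -/

instance : IsProbabilityMeasure angleMeasure := by
  constructor
  have h : (0 : ℝ) < 2 * Real.pi := by positivity
  rw [angleMeasure, Measure.smul_apply, Measure.restrict_apply_univ, Real.volume_Ioc, sub_zero,
    smul_eq_mul]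
  exact ENNReal.inv_mul_cancel (by simpa using h) ENNReal.ofReal_ne_top

theorem le_of_forall_ofReal_mul_le {a b : ℝ≥0∞}
    (h : ∀ c : ℝ, 0 < c → c < 1 → ENNReal.ofReal c * a ≤ b) : a ≤ b := by
  refine ENNReal.le_of_forall_lt_one_mul_le fun c hc => ?_
  rcases eq_or_ne c 0 with rfl | h0
  · simp
  have hct := hc.ne_top
  have := h c.toReal (ENNReal.toReal_pos h0 hct)
    (by rw [← ENNReal.toReal_one]; exact (ENNReal.toReal_lt_toReal hct ENNReal.one_ne_top).mpr hc)
  rwa [ENNReal.ofReal_toReal hct] at this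

theorem circleMap_mem_disc {r : ℝ} (h0 : 0 ≤ r) (h1 : r < 1) (θ : ℝ) : circleMap 0 r θ ∈ disc := by
  rw [mem_disc, norm_circleMap_zero, abs_of_nonneg h0]
  exact h1

theorem continuous_comp_circleMap {f : ℂ → ℂ} (hf : DifferentiableOn ℂ f disc) {r : ℝ}
    (h0 : 0 ≤ r) (h1 : r < 1) : Continuous fun θ : ℝ => f (circleMap 0 r θ) :=
  hf.continuousOn.comp_continuous (continuous_circleMap 0 r) (circleMap_mem_disc h0 h1)

theorem aestronglyMeasurable_comp_circleMap {f : ℂ → ℂ} (hf : DifferentiableOn ℂ f disc) {r : ℝ}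
    (h0 : 0 ≤ r) (h1 : r < 1) :
    AEStronglyMeasurable (fun θ : ℝ => f (circleMap 0 r θ)) angleMeasure :=
  (continuous_comp_circleMap hf h0 h1).aestronglyMeasurable

theorem eventually_Ioo {a : ℝ} (ha : a < 1) : ∀ᶠ r in 𝓝[<] (1 : ℝ), r ∈ Ioo a 1 :=
  Ioo_mem_nhdsLT ha

theorem hardyNorm_le_of_eventually {p : ℝ≥0∞} {f : ℂ → ℂ} {A : ℝ≥0∞}
    (h : ∀ᶠ r in 𝓝[<] (1 : ℝ), circleMean p f r ≤ A) : hardyNorm p f ≤ A :=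
  limsup_le_of_le (h := h)

theorem le_hardyNorm_of_eventually {p : ℝ≥0∞} {f : ℂ → ℂ} {A : ℝ≥0∞}
    (h : ∀ᶠ r in 𝓝[<] (1 : ℝ), A ≤ circleMean p f r) : A ≤ hardyNorm p f :=
  le_limsup_of_frequently_le h.frequently

theorem hardyNorm_mono {p : ℝ≥0∞} {f g : ℂ → ℂ} (h : ∀ z ∈ disc, ‖f z‖ ≤ ‖g z‖) :
    hardyNorm p f ≤ hardyNorm p g := by
  refine limsup_le_limsup ?_
  filter_upwards [eventually_Ioo zero_lt_one] with r hr
  exact eLpNorm_mono fun θ => h _ (circleMap_mem_disc hr.1.le hr.2 θ)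

theorem hardyNorm_const_smul (p : ℝ≥0∞) (c : ℂ) (f : ℂ → ℂ) :
    hardyNorm p (fun z => c * f z) = ‖c‖ₑ * hardyNorm p f := by
  have : circleMean p (fun z => c * f z) = fun r => ‖c‖ₑ * circleMean p f r := by
    ext r
    exact eLpNorm_const_smul c (fun θ : ℝ => f (circleMap 0 r θ)) p angleMeasure
  rw [hardyNorm, this, ENNReal.limsup_const_mul_of_ne_top enorm_ne_top, hardyNorm]

theorem hardyNorm_add_le {p : ℝ≥0∞} (hp : 1 ≤ p) {f g : ℂ → ℂ} (hf : DifferentiableOn ℂ f disc)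
    (hg : DifferentiableOn ℂ g disc) :
    hardyNorm p (fun z => f z + g z) ≤ hardyNorm p f + hardyNorm p g := by
  refine ENNReal.le_of_forall_pos_le_add fun ε hε hlt => ?_
  have hfin := ENNReal.add_lt_top.mp hlt
  have hε2 : ((ε / 2 : NNReal) : ℝ≥0∞) ≠ 0 := by simpa using hε.ne'
  have h1 := eventually_lt_of_limsup_lt (ENNReal.lt_add_right hfin.1.ne hε2)
  have h2 := eventually_lt_of_limsup_lt (ENNReal.lt_add_right hfin.2.ne hε2)
  refine hardyNorm_le_of_eventually ?_
  filter_upwards [h1, h2, eventually_Ioo zero_lt_one] with r hr1 hr2 hr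
  refine (eLpNorm_add_le (aestronglyMeasurable_comp_circleMap hf hr.1.le hr.2)
    (aestronglyMeasurable_comp_circleMap hg hr.1.le hr.2) hp).trans
    ((add_le_add hr1.le hr2.le).trans (le_of_eq ?_))
  rw [add_add_add_comm, ← ENNReal.coe_add, add_halves]
  rfl

theorem hardyNorm_le_of_bound {p : ℝ≥0∞} {f : ℂ → ℂ} {A : ℝ} (h : ∀ z ∈ disc, ‖f z‖ ≤ A) :
    hardyNorm p f ≤ ENNReal.ofReal A := by
  refine hardyNorm_le_of_eventually ?_
  filter_upwards [eventually_Ioo zero_lt_one] with r hr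
  refine (eLpNorm_le_of_ae_bound (C := A) (ae_of_all _ fun θ =>
    h _ (circleMap_mem_disc hr.1.le hr.2 θ))).trans ?_
  simp

theorem hardyNorm_sum_le {p : ℝ≥0∞} (hp : 1 ≤ p) {ι : Type*} (s : Finset ι) {f : ι → ℂ → ℂ}
    (hf : ∀ i ∈ s, DifferentiableOn ℂ (f i) disc) :
    hardyNorm p (fun z => ∑ i ∈ s, f i z) ≤ ∑ i ∈ s, hardyNorm p (f i) := by
  classical
  induction s using Finset.induction_on with
  | empty => simpa using hardyNorm_le_of_bound (p := p) (f := fun _ => 0) (A := 0) (by simp)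
  | insert a s ha ih =>
    simp only [Finset.sum_insert ha]
    have hs : ∀ i ∈ s, DifferentiableOn ℂ (f i) disc := fun i hi =>
      hf i (Finset.mem_insert_of_mem hi)
    exact (hardyNorm_add_le hp (hf a (Finset.mem_insert_self a s))
      (DifferentiableOn.fun_sum hs)).trans (add_le_add le_rfl (ih hs))

/-- Dividing by a finite Blaschke product does not increase the Hardy norm. -/
theorem hardyNorm_le_mul_blaschke {p : ℝ≥0∞} {g : ℂ → ℂ} {n : ℕ} {Z : Fin n → ℂ}
    (hZ : ∀ j, ‖Z j‖ < 1) : hardyNorm p g ≤ hardyNorm p fun z => g z * blaschke Z z := by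
  -- The Blaschke product has modulus at least c on all circles close enough to the boundary, for
  -- any c < 1.
  refine le_of_forall_ofReal_mul_le fun c hc0 hc1 => ?_
  have hsm : ENNReal.ofReal c * hardyNorm p g = hardyNorm p fun z => (c : ℂ) * g z := by
    rw [hardyNorm_const_smul, ← ofReal_norm, Complex.norm_real, Real.norm_of_nonneg hc0.le]
  rw [hsm]
  refine limsup_le_limsup ?_
  filter_upwards [eventually_Ioo zero_lt_one, eventually_le_norm_blaschke hZ hc1] with r hr hB
  refine eLpNorm_mono fun θ => ?_
  rw [norm_mul, norm_mul, Complex.norm_real, Real.norm_of_nonneg hc0.le, mul_comm]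
  gcongr
  exact hB _ (by rw [norm_circleMap_zero, abs_of_pos hr.1])

/-- Point evaluations on the disc of radius `R` are bounded on the Hardy spaces. -/
theorem enorm_le_mul_hardyNorm {p : ℝ≥0∞} (hp : 1 ≤ p) {f : ℂ → ℂ}
    (hf : DifferentiableOn ℂ f disc) {R : ℝ} (h0 : 0 ≤ R) (h1 : R < 1) {z : ℂ} (hz : ‖z‖ ≤ R) :
    ‖f z‖ₑ ≤ ENNReal.ofReal (2 / (1 - R)) * hardyNorm p f := by
  have hR : 0 < 1 - R := by linarith
  have hc : 0 < 2 / (1 - R) := by positivity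
  -- Cauchy's formula on |w| = r: for these r the point z is at distance at least (1 - R)/2 from the
  -- circle. The resulting 1-mean is at most the p-mean because `angleMeasure` is a probability
  -- measure.
  have hmean : ∀ r ∈ Ioo ((1 + R) / 2) 1,
      ‖f z‖ₑ ≤ ENNReal.ofReal (2 / (1 - R)) * circleMean p f r := by
    intro r hr
    have hr1 := hr.1
    have hr2 := hr.2
    have hr0 : 0 < r := by linarith
    have hzr : ‖z‖ < r := by linarith
    have hcl : DiffContOnCl ℂ f (Metric.ball 0 r) :=
      (hf.mono (Metric.closedBall_subset_ball hr.2)).diffContOnCl_ball subset_rfl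
    have hC := hcl.two_pi_i_inv_smul_circleIntegral_sub_inv_smul
      (w := z) (by simpa using hzr)
    have hle : ‖f z‖ₑ ≤ ENNReal.ofReal (2 / (1 - R)) * circleMean 1 f r := by
      rw [← hC, circleIntegral, intervalIntegral.integral_of_le (by positivity), enorm_smul,
        circleMean, eLpNorm_one_eq_lintegral_enorm, angleMeasure, lintegral_smul_measure]
      have hpi : (0 : ℝ) < 2 * Real.pi := by positivity
      have e1 : ‖(2 * Real.pi * Complex.I : ℂ)⁻¹‖ₑ = (ENNReal.ofReal (2 * Real.pi))⁻¹ := by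
        rw [enorm_inv (by simp [Real.pi_ne_zero])]
        congr 1
        rw [← ofReal_norm]
        simp [abs_of_pos Real.pi_pos]
      rw [e1, smul_eq_mul, mul_left_comm]
      refine mul_le_mul_right ?_ _
      refine (enorm_integral_le_lintegral_enorm _).trans ?_
      rw [← lintegral_const_mul' _ _ ENNReal.ofReal_ne_top]
      refine lintegral_mono fun θ => ?_
      have hn : ‖circleMap 0 r θ‖ = r := by rw [norm_circleMap_zero, abs_of_pos hr0]
      rw [enorm_smul, enorm_smul, ← mul_assoc]
      refine mul_le_mul_left ?_ _
      rw [← enorm_mul, ← ofReal_norm]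
      refine ENNReal.ofReal_le_ofReal ?_
      have hd : (1 - R) / 2 ≤ ‖circleMap 0 r θ - z‖ := by
        have := norm_sub_norm_le (circleMap 0 r θ) z
        rw [hn] at this
        linarith
      rw [deriv_circleMap, norm_mul, norm_mul, hn, Complex.norm_I, mul_one, norm_inv,
        ← div_eq_mul_inv]
      calc r / ‖circleMap 0 r θ - z‖ ≤ 1 / ((1 - R) / 2) := by gcongr
        _ = 2 / (1 - R) := by rw [one_div_div]
    refine hle.trans (mul_le_mul_right ?_ _)
    exact eLpNorm_le_eLpNorm_of_exponent_le hp
      (aestronglyMeasurable_comp_circleMap hf hr0.le hr.2)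
  have hdiv : ‖f z‖ₑ / ENNReal.ofReal (2 / (1 - R)) ≤ hardyNorm p f := by
    refine le_hardyNorm_of_eventually ?_
    filter_upwards [eventually_Ioo (show (1 + R) / 2 < 1 by linarith)] with r hr
    exact ENNReal.div_le_of_le_mul' (hmean r hr)
  rwa [ENNReal.div_le_iff' (by simpa using hc) ENNReal.ofReal_ne_top] at hdiv

/-- A function holomorphic on the disc that vanishes at finitely many distinct points is divisible
by their Blaschke product. -/
theorem exists_eq_mul_blaschke {n : ℕ} {Z : Fin n → ℂ} (hZ : ∀ j, ‖Z j‖ < 1)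
    (hinj : Function.Injective Z) {G : ℂ → ℂ} (hG : DifferentiableOn ℂ G disc)
    (h0 : ∀ j, G (Z j) = 0) :
    ∃ h : ℂ → ℂ, DifferentiableOn ℂ h disc ∧ ∀ z ∈ disc, G z = h z * blaschke Z z := by
  induction n generalizing G with
  | zero => exact ⟨G, hG, fun z _ => by simp [blaschke]⟩
  | succ n ih =>
    have hmem : disc ∈ 𝓝 (Z 0) := isOpen_disc.mem_nhds (mem_disc.mpr (hZ 0))
    have hfac : ∀ z, G z = (z - Z 0) * dslope G (Z 0) z := fun z => by
      have := sub_smul_dslope G (Z 0) z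
      rw [h0 0, sub_zero, smul_eq_mul] at this
      exact this.symm
    obtain ⟨h, hh, he⟩ := ih (Z := fun j => Z j.succ) (fun j => hZ _)
      (hinj.comp (Fin.succ_injective n))
      -- This is G divided by the factor at `Z 0`; it still vanishes at the remaining nodes because
      -- they differ from `Z 0`.
      (G := fun z => dslope G (Z 0) z * (1 - conj (Z 0) * z))
      (((Complex.differentiableOn_dslope hmem).mpr hG).mul (by fun_prop))
      (fun j => by
        have h1 := hfac (Z j.succ)
        rw [h0, eq_comm, mul_eq_zero] at h1
        rcases h1 with h1 | h1
        · exact absurd (hinj (sub_eq_zero.mp h1)) (Fin.succ_ne_zero j)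
        · simp [h1])
    refine ⟨h, hh, fun z hz => ?_⟩
    have hne := one_sub_conj_mul_ne_zero (hZ 0) (mem_disc.mp hz).le
    rw [blaschke_eq_prod, Fin.prod_univ_succ, mul_left_comm, ← blaschke_eq_prod, ← he z hz, hfac,
      factor, div_mul_eq_mul_div, eq_div_iff hne]
    ring

/-! ### The extremal products V and their maximizers -/

theorem enorm_factor_comm (a z : ℂ) : ‖factor a z‖ₑ = ‖factor z a‖ₑ := by
  rw [← ofReal_norm, norm_factor_comm, ofReal_norm]

theorem enorm_wBlaschke (q : ℂ → ℂ) {n : ℕ} (Z : Fin n → ℂ) (z : ℂ) :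
    ‖wBlaschke q Z z‖ₑ = ‖q z‖ₑ * ∏ j, ‖factor (Z j) z‖ₑ := by
  rw [wBlaschke, blaschke_eq_prod, enorm_mul]
  congr 1
  simp only [enorm_eq_nnnorm, nnnorm_prod, ENNReal.ofNNReal_finsetProd]

theorem feketeProduct_castSucc (q : ℂ → ℂ) {n : ℕ} (Z : Fin (n + 1) → ℂ) :
    feketeProduct q Z = feketeProduct q (fun i => Z i.castSucc) *
      ‖wBlaschke q (fun i => Z i.castSucc) (Z (Fin.last n))‖ₑ := by
  rw [feketeProduct, Fin.prod_univ_castSucc]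
  rfl

/-- Each unordered pair occurs once in V and |`factor a z`| is symmetric, so squaring turns V into a
product over ordered pairs, in which the order of the points is invisible. -/
theorem sq_feketeProduct (q : ℂ → ℂ) {n : ℕ} (Z : Fin n → ℂ) :
    feketeProduct q Z ^ 2 = (∏ j, ‖q (Z j)‖ₑ) ^ 2 *
      ∏ j, ∏ i, if i = j then 1 else ‖factor (Z i) (Z j)‖ₑ := by
  induction n with
  | zero => simp [feketeProduct]
  | succ n ih =>
    rw [feketeProduct_castSucc, mul_pow, ih, enorm_wBlaschke]
    simp only [Fin.prod_univ_castSucc, Finset.prod_mul_distrib, Fin.castSucc_inj,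
      Fin.castSucc_ne_last, (Fin.castSucc_ne_last _).symm, if_true, if_false, mul_one]
    simp only [enorm_factor_comm (Z (Fin.last n))]
    ring

/-- The product `V` is symmetric in the points. -/
theorem feketeProduct_comp_equiv (q : ℂ → ℂ) {m n : ℕ} (Z : Fin n → ℂ) (e : Fin m ≃ Fin n) :
    feketeProduct q (Z ∘ e) = feketeProduct q Z := by
  refine (ENNReal.pow_right_strictMono two_ne_zero).injective ?_
  simp only [sq_feketeProduct, Function.comp_apply]
  rw [e.prod_comp fun j => ‖q (Z j)‖ₑ, ← e.prod_comp fun j => ∏ i, if i = j then (1 : ℝ≥0∞) else _]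
  congr 1
  refine Finset.prod_congr rfl fun j _ => ?_
  rw [← e.prod_comp fun i => if i = e j then (1 : ℝ≥0∞) else _]
  simp

/-- By symmetry any point may be taken as the last one. -/
theorem feketeProduct_succAbove (q : ℂ → ℂ) {n : ℕ} (Z : Fin (n + 1) → ℂ) (j : Fin (n + 1)) :
    feketeProduct q Z = feketeProduct q (fun i => Z (j.succAbove i)) *
      ‖wBlaschke q (fun i => Z (j.succAbove i)) (Z j)‖ₑ := by
  let e : Fin (n + 1) ≃ Fin (n + 1) := finSuccEquivLast.trans (finSuccEquiv' j).symm
  have h1 : ∀ i : Fin n, e i.castSucc = j.succAbove i := fun i => by simp [e]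
  have h2 : e (Fin.last n) = j := by simp [e]
  rw [← feketeProduct_comp_equiv q Z e, feketeProduct_castSucc]
  simp only [Function.comp_apply, h1, h2]

variable {E : Set ℂ} {q : ℂ → ℂ}

theorem IsRelClosed.norm_lt_one (hE : IsRelClosed E) {z : ℂ} (hz : z ∈ E) : ‖z‖ < 1 := by
  rw [← hE] at hz
  exact mem_disc.mp hz.2

theorem IsWeight.norm_le_one (hq : IsWeight E q) {z : ℂ} (hz : ‖z‖ < 1) : ‖q z‖ ≤ 1 := by
  have h : ‖q z‖ₑ ≤ 1 := by
    rw [← hq.sup_eq_one]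
    exact le_iSup₂ (f := fun z (_ : z ∈ disc) => ‖q z‖ₑ) z (mem_disc.mpr hz)
  rwa [← ofReal_norm, ← ENNReal.ofReal_one, ENNReal.ofReal_le_ofReal_iff zero_le_one] at h

theorem IsWeight.norm_wBlaschke_le_one (hq : IsWeight E q) {n : ℕ} {Z : Fin n → ℂ}
    (hZ : ∀ j, ‖Z j‖ < 1) {z : ℂ} (hz : ‖z‖ < 1) : ‖wBlaschke q Z z‖ ≤ 1 := by
  rw [wBlaschke, norm_mul]
  exact mul_le_one₀ (hq.norm_le_one hz) (norm_nonneg _) (norm_blaschke_le_one hZ hz.le)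

theorem IsWeight.differentiableOn_wBlaschke (hq : IsWeight E q) {n : ℕ} {Z : Fin n → ℂ}
    (hZ : ∀ j, ‖Z j‖ < 1) : DifferentiableOn ℂ (wBlaschke q Z) disc :=
  hq.holo.mul (differentiableOn_blaschke hZ)

theorem feketeProduct_le_feketeSup {n : ℕ} {Z : Fin n → ℂ} (hZ : ∀ j, Z j ∈ E) :
    feketeProduct q Z ≤ feketeSup E q n :=
  le_iSup₂ (f := fun Z (_ : Z ∈ {Z : Fin n → ℂ | ∀ j, Z j ∈ E}) => feketeProduct q Z) Z hZ

theorem feketeSup_le_one (hE : IsRelClosed E) (hq : IsWeight E q) (n : ℕ) :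
    feketeSup E q n ≤ 1 := by
  refine iSup₂_le fun Z hZ => Finset.prod_le_one' fun j _ => ?_
  rw [← ofReal_norm, ENNReal.ofReal_le_one]
  exact hq.norm_wBlaschke_le_one (fun i => hE.norm_lt_one (hZ _)) (hE.norm_lt_one (hZ j))

theorem feketeSup_pos (hE : IsRelClosed E) (hN : IsNonBlaschke E) (hq : IsWeight E q) (n : ℕ) :
    0 < feketeSup E q n := by
  obtain ⟨z, hz, hzE, -⟩ := hN
  refine lt_of_lt_of_le ?_ (feketeProduct_le_feketeSup (Z := fun j : Fin n => z j) fun j => hzE j)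
  rw [pos_iff_ne_zero, feketeProduct, Finset.prod_ne_zero_iff]
  intro j _
  rw [enorm_ne_zero, wBlaschke]
  have hj := hE.norm_lt_one (hzE j)
  refine mul_ne_zero (hq.ne_zero _ (mem_disc.mpr hj)) ?_
  rw [blaschke_eq_prod, Finset.prod_ne_zero_iff]
  intro i _
  refine factor_ne_zero (hE.norm_lt_one (hzE _)) hj.le fun h => ?_
  have := hz h
  simp at this
  omega

/-- The points of a tuple with non-vanishing product are distinct. -/
theorem injective_of_feketeProduct_ne_zero {n : ℕ} {Z : Fin n → ℂ} (h : feketeProduct q Z ≠ 0) :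
    Function.Injective Z := by
  have hlt : ∀ i j : Fin n, i < j → Z i ≠ Z j := by
    intro i j hij he
    rw [feketeProduct, Finset.prod_ne_zero_iff] at h
    refine h j (Finset.mem_univ j) ?_
    rw [enorm_wBlaschke]
    refine mul_eq_zero_of_right _ (Finset.prod_eq_zero (Finset.mem_univ ⟨i, hij⟩) ?_)
    simp [he, factor_self]
  intro i j he
  rcases lt_trichotomy i j with h1 | h1 | h1
  · exact absurd he (hlt i j h1)
  · exact h1
  · exact absurd he.symm (hlt j i h1)

/-- Append an arbitrary point of E to a maximizing n-tuple. Finiteness of M_n guarantees that such a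
tuple exists, the infimum over the empty set being ∞. -/
theorem feketeSup_mul_feketeM_le {n : ℕ} (hM : feketeM E q n ≠ ∞) :
    feketeSup E q n * feketeM E q n ≤ feketeSup E q (n + 1) := by
  have hex : ∃ Z : Fin n → ℂ, (∀ j, Z j ∈ E) ∧ feketeProduct q Z = feketeSup E q n := by
    by_contra hne
    push Not at hne
    refine hM ?_
    rw [feketeM, iInf₂_eq_top]
    exact fun Z hZ => absurd hZ.2 (hne Z hZ.1)
  obtain ⟨Z, hZE, hZ⟩ := hex
  have hle : feketeM E q n ≤ supOn E q Z :=
    iInf₂_le (f := fun Z (_ : Z ∈ {Z : Fin n → ℂ | (∀ j, Z j ∈ E) ∧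
      feketeProduct q Z = feketeSup E q n}) => supOn E q Z) Z ⟨hZE, hZ⟩
  refine (mul_le_mul_right hle _).trans ?_
  rw [supOn, ENNReal.mul_iSup]
  refine iSup_le fun z => ?_
  rw [ENNReal.mul_iSup]
  refine iSup_le fun hz => ?_
  refine le_trans (le_of_eq ?_) (feketeProduct_le_feketeSup
    (Z := (Fin.snoc Z z : Fin (n + 1) → ℂ)) fun j => ?_)
  · rw [feketeProduct_castSucc]
    simp only [Fin.snoc_castSucc, Fin.snoc_last, hZ]
  · refine Fin.lastCases ?_ (fun i => ?_) j
    · simpa using hz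
    · simpa using hZE i

/-- For a maximizing tuple, every weighted Blaschke product with one zero left out is bounded below
at the omitted point. -/
theorem le_enorm_wBlaschke_succAbove {n : ℕ} {Z : Fin (n + 1) → ℂ} (hZE : ∀ j, Z j ∈ E)
    {τ : ℝ≥0∞} (hτ : τ * feketeSup E q n ≤ feketeProduct q Z)
    (h0 : feketeProduct q Z ≠ 0) (htop : feketeSup E q n ≠ ∞) (j : Fin (n + 1)) :
    τ ≤ ‖wBlaschke q (fun i => Z (j.succAbove i)) (Z j)‖ₑ := by
  have hle : feketeProduct q (fun i => Z (j.succAbove i)) ≤ feketeSup E q n :=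
    feketeProduct_le_feketeSup fun i => hZE _
  have hV : feketeProduct q (fun i => Z (j.succAbove i)) ≠ 0 := by
    intro h
    rw [feketeProduct_succAbove q Z j, h, zero_mul] at h0
    exact h0 rfl
  have h := (mul_le_mul_right hle τ).trans hτ
  rw [feketeProduct_succAbove q Z j, mul_comm τ] at h
  exact (ENNReal.mul_le_mul_iff_right hV (ne_top_of_le_ne_top htop hle)).mp h

/-! ### Interpolation and the upper bound -/

theorem wBlaschke_succAbove_of_ne (q : ℂ → ℂ) {n : ℕ} (Z : Fin (n + 1) → ℂ) {j k : Fin (n + 1)}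
    (h : k ≠ j) : wBlaschke q (fun i => Z (j.succAbove i)) (Z k) = 0 := by
  obtain ⟨i, rfl⟩ := Fin.exists_succAbove_eq h
  rw [wBlaschke, blaschke_eq_prod, Finset.prod_eq_zero (Finset.mem_univ i) (factor_self _),
    mul_zero]

/-- The omitted point has max(R, |Z_j|) ≥ R, so restoring it to the product costs at most R⁻¹ before
the exponent is applied. -/
theorem norm_blaschke_succAbove_le {R : ℝ} (h0 : 0 < R) (h1 : R < 1) {n : ℕ}
    {Z : Fin (n + 1) → ℂ} (hZ : ∀ j, ‖Z j‖ < 1) (j : Fin (n + 1)) {z : ℂ} (hz : ‖z‖ ≤ R) :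
    ‖blaschke (fun i => Z (j.succAbove i)) z‖ ≤
      R ^ (-exponent R) * (∏ i, max R ‖Z i‖) ^ exponent R := by
  have hα := exponent_pos h0 h1
  have hm : ∀ i, R ≤ max R ‖Z i‖ := fun i => le_max_left _ _
  have hP : 0 ≤ ∏ i, max R ‖Z (j.succAbove i)‖ :=
    Finset.prod_nonneg fun i _ => h0.le.trans (hm _)
  have hle : ∏ i, max R ‖Z (j.succAbove i)‖ ≤ R⁻¹ * ∏ i, max R ‖Z i‖ := by
    rw [Fin.prod_univ_succAbove _ j, ← mul_assoc]
    refine le_mul_of_one_le_left hP ?_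
    rw [inv_mul_eq_div, one_le_div h0]
    exact hm j
  refine (norm_blaschke_le_rpow h0 h1 (fun i => hZ _) hz).trans
    ((Real.rpow_le_rpow hP hle hα.le).trans (le_of_eq ?_))
  rw [Real.mul_rpow (inv_nonneg.mpr h0.le)
    (Finset.prod_nonneg fun i _ => h0.le.trans (hm i)), Real.inv_rpow h0.le, Real.rpow_neg h0.le]

/-- The constant in the upper bound for the stability modulus. -/
noncomputable def stabilityConst (R : ℝ) : ℝ := R ^ (-exponent R) + 4 / (1 - R)

theorem stabilityConst_pos {R : ℝ} (h0 : 0 < R) (h1 : R < 1) : 0 < stabilityConst R := by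
  have : 0 < 1 - R := by linarith
  have := Real.rpow_pos_of_pos h0 (-exponent R)
  unfold stabilityConst
  positivity

/-- Lagrange interpolation by weighted Blaschke products bounds a function in the unit ball of
`H^p` that is small at the nodes. -/
theorem norm_le_of_interpolation (hq : IsWeight E q) {p : ℝ≥0∞} (hp : 1 ≤ p) {R : ℝ} (h0 : 0 < R)
    (h1 : R < 1) {f : ℂ → ℂ} (hf : DifferentiableOn ℂ f disc) (hf1 : hardyNorm p f ≤ 1) {n : ℕ}
    {Z : Fin (n + 1) → ℂ} (hZ : ∀ j, ‖Z j‖ < 1) (hinj : Function.Injective Z) {ε τ : ℝ}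
    (hε : ∀ j, ‖f (Z j)‖ ≤ ε) (hτ0 : 0 < τ)
    (hτ : ∀ j, τ ≤ ‖wBlaschke q (fun i => Z (j.succAbove i)) (Z j)‖)
    (hετ : (n + 1 : ℝ) * ε ≤ τ) {z : ℂ} (hz : ‖z‖ ≤ R) :
    ‖f z‖ ≤ stabilityConst R * (∏ j, max R ‖Z j‖) ^ exponent R := by
  set W : Fin (n + 1) → ℂ → ℂ := fun j => wBlaschke q fun i => Z (j.succAbove i) with hW
  -- Lagrange coefficients: W_j vanishes at every node but the j-th, so f + Σ c_j W_j vanishes at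
  -- all nodes.
  set c : Fin (n + 1) → ℂ := fun j => -(f (Z j) / W j (Z j)) with hc
  set P : ℝ := (∏ j, max R ‖Z j‖) ^ exponent R with hPdef
  have hWne : ∀ j, W j (Z j) ≠ 0 := fun j => norm_pos_iff.mp (hτ0.trans_le (hτ j))
  have hcn : ∀ j, ‖c j‖ ≤ ε / τ := fun j => by
    rw [hc, norm_neg, norm_div]
    have h1 := hε j
    have h2 := hτ j
    have := (norm_nonneg _).trans h1
    gcongr
  have hsum1 : (∑ _j : Fin (n + 1), ε / τ) ≤ 1 := by
    rw [Finset.sum_const, Finset.card_univ, Fintype.card_fin, nsmul_eq_mul, ← mul_div_assoc,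
      div_le_one hτ0]
    exact_mod_cast hετ
  have hWd : ∀ j, DifferentiableOn ℂ (W j) disc := fun j =>
    hq.differentiableOn_wBlaschke fun i => hZ _
  have hcWd : ∀ j ∈ Finset.univ, DifferentiableOn ℂ (fun w => c j * W j w) disc := fun j _ =>
    (hWd j).const_mul _
  set G : ℂ → ℂ := fun w => f w + ∑ j, c j * W j w with hGdef
  have hGd : DifferentiableOn ℂ G disc := hf.add (DifferentiableOn.fun_sum hcWd)
  have hG0 : ∀ k, G (Z k) = 0 := fun k => by
    have : ∑ j, c j * W j (Z k) = c k * W k (Z k) :=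
      Finset.sum_eq_single k (fun j _ hj => by
        rw [show W j (Z k) = 0 from wBlaschke_succAbove_of_ne q Z hj.symm, mul_zero]) (by simp)
    rw [hGdef]
    simp only [this]
    rw [hc, neg_mul, div_mul_cancel₀ _ (hWne k), add_neg_cancel]
  have hε0 : 0 ≤ ε / τ := div_nonneg ((norm_nonneg _).trans (hε 0)) hτ0.le
  have hGn : hardyNorm p G ≤ ENNReal.ofReal 2 := by
    refine (hardyNorm_add_le hp hf (DifferentiableOn.fun_sum hcWd)).trans ?_
    have hs : hardyNorm p (fun w => ∑ j, c j * W j w) ≤ 1 := by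
      refine (hardyNorm_sum_le hp _ hcWd).trans ?_
      refine (Finset.sum_le_sum fun j _ => (hardyNorm_le_of_bound (A := ε / τ) fun w hw => ?_)).trans
        ?_
      · rw [norm_mul]
        exact (mul_le_of_le_one_right (norm_nonneg _)
          (hq.norm_wBlaschke_le_one (fun i => hZ _) (mem_disc.mp hw))).trans (hcn j)
      · rw [← ENNReal.ofReal_sum_of_nonneg fun _ _ => hε0, ENNReal.ofReal_le_one]
        exact hsum1
    refine (add_le_add hf1 hs).trans (le_of_eq ?_)
    rw [one_add_one_eq_two, ENNReal.ofReal_ofNat]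
  obtain ⟨h, hhd, hGh⟩ := exists_eq_mul_blaschke hZ hinj hGd hG0
  have hhn : hardyNorm p h ≤ ENNReal.ofReal 2 :=
    (hardyNorm_le_mul_blaschke hZ).trans
      ((hardyNorm_mono fun w hw => by rw [hGh w hw]).trans hGn)
  have hR : 0 < 1 - R := by linarith
  -- The norm bound 2 times the point evaluation constant 2/(1 - R).
  have hhz : ‖h z‖ ≤ 4 / (1 - R) := by
    have := (enorm_le_mul_hardyNorm hp hhd h0.le h1 hz).trans (mul_le_mul_right hhn _)
    rw [← ENNReal.ofReal_mul (by positivity), ← ofReal_norm,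
      ENNReal.ofReal_le_ofReal_iff (by positivity)] at this
    exact this.trans (le_of_eq (by ring))
  have hzd : ‖z‖ < 1 := hz.trans_lt h1
  have hfz : f z = h z * blaschke Z z - ∑ j, c j * W j z := by
    rw [← hGh z (mem_disc.mpr hzd), hGdef]
    ring
  have hP0 : 0 ≤ P := Real.rpow_nonneg
    (Finset.prod_nonneg fun i _ => h0.le.trans (le_max_left _ _)) _
  have hWz : ∀ j, ‖W j z‖ ≤ R ^ (-exponent R) * P := fun j => by
    rw [hW]
    simp only [wBlaschke, norm_mul]
    exact (mul_le_of_le_one_left (norm_nonneg _) (hq.norm_le_one hzd)).trans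
      (norm_blaschke_succAbove_le h0 h1 hZ j hz)
  have hs : ‖∑ j, c j * W j z‖ ≤ R ^ (-exponent R) * P := by
    refine (norm_sum_le _ _).trans ((Finset.sum_le_sum (g := fun _ =>
      ε / τ * (R ^ (-exponent R) * P)) fun j _ => ?_).trans ?_)
    · rw [norm_mul]
      exact mul_le_mul (hcn j) (hWz j) (norm_nonneg _) hε0
    · rw [← Finset.sum_mul]
      exact mul_le_of_le_one_left (mul_nonneg (Real.rpow_nonneg h0.le _) hP0) hsum1
  rw [hfz, stabilityConst, add_mul, add_comm (_ * P)]
  refine (norm_sub_le _ _).trans (add_le_add ?_ hs)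
  rw [norm_mul]
  exact mul_le_mul hhz (norm_blaschke_le_rpow h0 h1 hZ hz) (norm_nonneg _) (by positivity)

theorem enorm_le_blaschkeModulus {ε R : ℝ} {n : ℕ} {Z : Fin n → ℂ} (hZE : ∀ j, Z j ∈ E)
    (hε : ∀ ζ ∈ E, ‖wBlaschke q Z ζ‖ ≤ ε) {z : ℂ} (hz : ‖z‖ ≤ R) :
    ‖wBlaschke q Z z‖ₑ ≤ blaschkeModulus E ε R q := by
  unfold blaschkeModulus
  refine le_iSup_of_le n (le_iSup₂_of_le Z ⟨hZE, hε⟩ (le_iSup₂_of_le z hz le_rfl))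

theorem blaschkeModulus_le_one (hE : IsRelClosed E) (hq : IsWeight E q) {ε R : ℝ} (h1 : R < 1) :
    blaschkeModulus E ε R q ≤ 1 := by
  refine iSup_le fun n => iSup₂_le fun Z hZ => iSup₂_le fun z hz => ?_
  rw [← ofReal_norm, ENNReal.ofReal_le_one]
  exact hq.norm_wBlaschke_le_one (fun j => hE.norm_lt_one (hZ.1 j)) (lt_of_le_of_lt hz h1)

/-- The upper bound for the stability modulus given by a tuple with well separated nodes. -/
theorem stabilityModulus_le (hE : IsRelClosed E) (hq : IsWeight E q) {p : ℝ≥0∞} (hp : 1 ≤ p)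
    {R : ℝ} (h0 : 0 < R) (h1 : R < 1) {n : ℕ} {Z : Fin (n + 1) → ℂ} (hZE : ∀ j, Z j ∈ E)
    (hinj : Function.Injective Z) {ε τ δ : ℝ} (hτ0 : 0 < τ)
    (hτ : ∀ j, τ ≤ ‖wBlaschke q (fun i => Z (j.succAbove i)) (Z j)‖)
    (hετ : (n + 1 : ℝ) * ε ≤ τ) (hδ : ∀ ζ ∈ E, ‖wBlaschke q Z ζ‖ ≤ δ) :
    stabilityModulus p E ε R ≤ ENNReal.ofReal (stabilityConst R * ‖q 0‖ ^ (-exponent R)) *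
      blaschkeModulus E δ R q ^ exponent R := by
  have hZ : ∀ j, ‖Z j‖ < 1 := fun j => hE.norm_lt_one (hZE j)
  have hα := exponent_pos h0 h1
  have hq0 : 0 < ‖q 0‖ := norm_pos_iff.mpr (hq.ne_zero 0 (by simp [mem_disc]))
  set g := blaschkeModulus E δ R q with hg
  have hgt : g ≠ ∞ := ne_top_of_le_ne_top ENNReal.one_ne_top (blaschkeModulus_le_one hE hq h1)
  have hprod : ∏ j, max R ‖Z j‖ ≤ ‖q 0‖⁻¹ * g.toReal := by
    rw [inv_mul_eq_div, le_div_iff₀ hq0, mul_comm]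
    refine norm_zero_mul_prod_le hq.holo h0 h1 hZ fun z hz => ?_
    rw [← toReal_enorm]
    exact ENNReal.toReal_mono hgt (enorm_le_blaschkeModulus hZE hδ hz)
  have hP0 : 0 ≤ ∏ j, max R ‖Z j‖ :=
    Finset.prod_nonneg fun i _ => h0.le.trans (le_max_left _ _)
  have hK := stabilityConst_pos h0 h1
  refine iSup₂_le fun f hf => iSup₂_le fun z hz => ?_
  have hfz := norm_le_of_interpolation hq hp h0 h1 hf.1.1.1 hf.1.2.le hZ hinj
    (fun j => hf.2 _ (hZE j)) hτ0 hτ hετ hz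
  have hle : ‖f z‖ ≤ stabilityConst R * ‖q 0‖ ^ (-exponent R) * g.toReal ^ exponent R := by
    refine hfz.trans ?_
    rw [mul_assoc, Real.rpow_neg hq0.le, ← Real.inv_rpow hq0.le,
      ← Real.mul_rpow (inv_nonneg.mpr hq0.le) ENNReal.toReal_nonneg]
    gcongr
  rw [← ofReal_norm]
  refine (ENNReal.ofReal_le_ofReal hle).trans (le_of_eq ?_)
  rw [ENNReal.ofReal_mul (by positivity), ENNReal.toReal_rpow,
    ENNReal.ofReal_toReal (ENNReal.rpow_ne_top_of_nonneg hα.le hgt)]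

/-! ### The lower bound -/

/-- Rotate b to the argument of a: a nonnegative multiple of it then points in the direction of a.
-/
theorem exists_unimodular_le_norm_add (c : ℝ) (a b : ℂ) :
    ∃ u : ℂ, ‖u‖ = 1 ∧ ∀ t : ℝ, 0 ≤ t → c * ‖a‖ ≤ ‖c * a + t * (u * b)‖ := by
  have hn : ∀ x : ℝ, ‖Complex.exp (x * Complex.I)‖ = 1 := Complex.norm_exp_ofReal_mul_I
  refine ⟨Complex.exp (a.arg * Complex.I) / Complex.exp (b.arg * Complex.I),
    by rw [norm_div, hn, hn, div_one], fun t ht => ?_⟩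
  have e : (c : ℂ) * a + t * (Complex.exp (a.arg * Complex.I) /
      Complex.exp (b.arg * Complex.I) * b) =
      ((c * ‖a‖ + t * ‖b‖ : ℝ) : ℂ) * Complex.exp (a.arg * Complex.I) := by
    have ha := Complex.norm_mul_exp_arg_mul_I a
    have hb : Complex.exp (a.arg * Complex.I) / Complex.exp (b.arg * Complex.I) * b =
        ‖b‖ * Complex.exp (a.arg * Complex.I) := by
      rw [div_mul_eq_mul_div, div_eq_iff (Complex.exp_ne_zero _)]
      linear_combination (-Complex.exp (a.arg * Complex.I)) * Complex.norm_mul_exp_arg_mul_I b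
    rw [hb]
    push_cast
    linear_combination (-(c : ℂ)) * ha
  rw [e, norm_mul, hn, mul_one, Complex.norm_real]
  have := mul_nonneg ht (norm_nonneg b)
  exact (by linarith : c * ‖a‖ ≤ c * ‖a‖ + t * ‖b‖).trans (le_abs_self _)

/-- The weighted Blaschke products with small supremum on `E` give a lower bound for the stability
modulus. -/
theorem blaschkeModulus_le_stabilityModulus (hE : IsRelClosed E) (hq : IsWeight E q)
    (hsmall : ∀ δ : ℝ, 0 < δ → ∃ (n : ℕ) (Z : Fin n → ℂ), (∀ j, Z j ∈ E) ∧
      ∀ ζ ∈ E, ‖wBlaschke q Z ζ‖ ≤ δ)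
    {p : ℝ≥0∞} (hp : 1 ≤ p) {ε R : ℝ} (hε : 0 < ε) :
    blaschkeModulus E ε R q ≤ stabilityModulus p E ε R := by
  refine iSup_le fun n => iSup₂_le fun Z hZ => iSup₂_le fun z hz => ?_
  refine le_of_forall_ofReal_mul_le fun c hc0 hc1 => ?_
  have hq0 : 0 < ‖q 0‖ := norm_pos_iff.mpr (hq.ne_zero 0 (by simp [mem_disc]))
  -- The correction k has norm at least |q(0)|/2, so T k has norm at least 2 and outweighs c h, of
  -- norm at most 1, by at least 1. On E, c h uses cε of the allowance, and t k with t ≤ T stays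
  -- within the remaining (1 - c)ε.
  set T : ℝ := 4 / ‖q 0‖ with hT
  have hT0 : 0 < T := by positivity
  obtain ⟨m, Y, hYE, hY⟩ := hsmall ((1 - c) * ε / T)
    (div_pos (mul_pos (by linarith) hε) hT0)
  have hZ1 : ∀ j, ‖Z j‖ < 1 := fun j => hE.norm_lt_one (hZ.1 j)
  have hY1 : ∀ j, ‖Y j‖ < 1 := fun j => hE.norm_lt_one (hYE j)
  set h := wBlaschke q Z with hh
  set k := wBlaschke q Y with hk
  have hhd : DifferentiableOn ℂ h disc := hq.differentiableOn_wBlaschke hZ1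
  have hkd : DifferentiableOn ℂ k disc := hq.differentiableOn_wBlaschke hY1
  have hh1 : hardyNorm p h ≤ 1 := by
    have := hardyNorm_le_of_bound (p := p) (f := h) (A := 1) fun w hw =>
      hq.norm_wBlaschke_le_one hZ1 (mem_disc.mp hw)
    rwa [ENNReal.ofReal_one] at this
  have hk1 : hardyNorm p k ≤ 1 := by
    have := hardyNorm_le_of_bound (p := p) (f := k) (A := 1) fun w hw =>
      hq.norm_wBlaschke_le_one hY1 (mem_disc.mp hw)
    rwa [ENNReal.ofReal_one] at this
  have hklow : ENNReal.ofReal (‖q 0‖ / 2) ≤ hardyNorm p k := by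
    refine le_trans ?_ (hardyNorm_le_mul_blaschke (p := p) (g := q) hY1)
    have := enorm_le_mul_hardyNorm hp hq.holo le_rfl zero_lt_one (z := 0) (by simp)
    rw [sub_zero, div_one] at this
    rw [ENNReal.ofReal_div_of_pos two_pos, ofReal_norm]
    exact ENNReal.div_le_of_le_mul' this
  obtain ⟨u, hu1, hu⟩ : ∃ u : ℂ, ‖u‖ = 1 ∧
      ∀ t : ℝ, 0 ≤ t → c * ‖h z‖ ≤ ‖c * h z + t * (u * k z)‖ :=
    exists_unimodular_le_norm_add c _ _
  set F : ℝ → ℂ → ℂ := fun t w => c * h w + t * (u * k w) with hF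
  have hFd : ∀ t, DifferentiableOn ℂ (F t) disc := fun t =>
    (hhd.const_mul _).add ((hkd.const_mul u).const_mul _)
  -- The norm is 1-Lipschitz in t, hence continuous; it is at most 1 at 0 and at least 1 at T, so it
  -- equals 1 somewhere between.
  have hLip : ∀ s t, hardyNorm p (F s) ≤ hardyNorm p (F t) + ENNReal.ofReal |s - t| := by
    intro s t
    have e : F s = fun w => F t w + ((s - t : ℝ) * u) * k w := by
      ext w
      simp only [hF]
      push_cast
      ring
    rw [e]
    refine (hardyNorm_add_le hp (hFd t) (hkd.const_mul _)).trans (add_le_add le_rfl ?_)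
    rw [hardyNorm_const_smul, enorm_mul, ← ofReal_norm u, hu1, ENNReal.ofReal_one, mul_one,
      ← ofReal_norm, Complex.norm_real, Real.norm_eq_abs]
    exact mul_le_of_le_one_right zero_le hk1
  have hF0 : hardyNorm p (F 0) ≤ 1 := by
    have e : F 0 = fun w => (c : ℂ) * h w := by
      ext w
      simp [hF]
    rw [e, hardyNorm_const_smul, ← ofReal_norm, Complex.norm_real, Real.norm_of_nonneg hc0.le]
    exact mul_le_one' (ENNReal.ofReal_le_one.mpr hc1.le) hh1
  have hFtop : ∀ t, hardyNorm p (F t) ≠ ∞ := fun t =>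
    ne_top_of_le_ne_top (by simp) ((hLip t 0).trans (add_le_add hF0 le_rfl))
  have hFT : 1 ≤ hardyNorm p (F T) := by
    have e : (fun w => (T * u : ℂ) * k w) = fun w => F T w + (-c : ℂ) * h w := by
      ext w
      simp only [hF]
      ring
    have h2 : ENNReal.ofReal 2 ≤ hardyNorm p fun w => (T * u : ℂ) * k w := by
      rw [hardyNorm_const_smul, enorm_mul, ← ofReal_norm u, hu1, ENNReal.ofReal_one, mul_one,
        ← ofReal_norm, Complex.norm_real, Real.norm_of_nonneg hT0.le]
      refine le_trans (le_of_eq ?_) (mul_le_mul_right hklow _)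
      rw [← ENNReal.ofReal_mul hT0.le, hT]
      congr 1
      field_simp
      norm_num
    rw [e] at h2
    have h3 := h2.trans (hardyNorm_add_le hp (hFd T) (hhd.const_mul _))
    rw [hardyNorm_const_smul, enorm_neg, ← ofReal_norm, Complex.norm_real,
      Real.norm_of_nonneg hc0.le] at h3
    have h4 := h3.trans (add_le_add le_rfl
      (mul_le_one' (ENNReal.ofReal_le_one.mpr hc1.le) hh1))
    rw [ENNReal.ofReal_ofNat, ← one_add_one_eq_two] at h4
    exact (ENNReal.add_le_add_iff_right ENNReal.one_ne_top).mp h4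
  have hcont : Continuous fun t => (hardyNorm p (F t)).toReal := by
    refine (LipschitzWith.of_le_add fun s t => ?_).continuous
    rw [Real.dist_eq]
    have := ENNReal.toReal_mono (by simp [hFtop]) (hLip s t)
    rwa [ENNReal.toReal_add (hFtop t) ENNReal.ofReal_ne_top,
      ENNReal.toReal_ofReal (abs_nonneg _)] at this
  obtain ⟨t, ht, hFt⟩ := intermediate_value_Icc hT0.le hcont.continuousOn
    (show (1 : ℝ) ∈ _ from ⟨by simpa using ENNReal.toReal_mono ENNReal.one_ne_top hF0,
      by simpa using ENNReal.toReal_mono (hFtop T) hFT⟩)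
  have hFt1 : hardyNorm p (F t) = 1 := (ENNReal.toReal_eq_one_iff _).mp hFt
  have hFE : ∀ ζ ∈ E, ‖F t ζ‖ ≤ ε := by
    intro ζ hζ
    have a1 := hZ.2 ζ hζ
    have a2 := hY ζ hζ
    refine (norm_add_le _ _).trans ?_
    rw [norm_mul, norm_mul, norm_mul, hu1, one_mul, Complex.norm_real, Complex.norm_real,
      Real.norm_of_nonneg hc0.le, Real.norm_of_nonneg ht.1]
    have b1 : c * ‖h ζ‖ ≤ c * ε := by gcongr
    have b2 : t * ‖k ζ‖ ≤ T * ((1 - c) * ε / T) := mul_le_mul ht.2 a2 (norm_nonneg _) hT0.le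
    rw [mul_div_cancel₀ _ hT0.ne'] at b2
    linarith
  have hmem : F t ∈ {f : ℂ → ℂ | f ∈ hardySphere p ∧ ∀ ζ ∈ E, ‖f ζ‖ ≤ ε} :=
    ⟨⟨⟨hFd t, by rw [hFt1]; exact ENNReal.one_lt_top⟩, hFt1⟩, hFE⟩
  refine le_trans ?_ (le_iSup₂_of_le (F t) hmem (le_iSup₂_of_le z hz le_rfl))
  rw [← ofReal_norm, ← ofReal_norm, ← ENNReal.ofReal_mul hc0.le]
  exact ENNReal.ofReal_le_ofReal (hu t ht.1)

/-! ### Polynomial decay and the choice of the tuple -/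

/-- The polynomial decay of `Mₙ(E)` with constant `C` and rate `σ` from the index `N` on. -/
def FeketeDecay (E : Set ℂ) (q : ℂ → ℂ) (C σ : ℝ) (N : ℕ) : Prop :=
  0 < C ∧ 0 < σ ∧ 0 < N ∧
    ∀ n : ℕ, N ≤ n → feketeM E q n ≤ ENNReal.ofReal (C * (n : ℝ) ^ (-σ))

/-- The exponent of `ε` belonging to the decay rate `s`. -/
noncomputable def decayExponent (s : ℝ) : ℝ := s / (2 * (1 + s))

theorem decayExponent_pos {s : ℝ} (hs : 0 < s) : 0 < decayExponent s := by
  unfold decayExponent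
  positivity

theorem decayExponent_mono {s t : ℝ} (hs : 0 < s) (h : s ≤ t) :
    decayExponent s ≤ decayExponent t := by
  unfold decayExponent
  rw [div_le_div_iff₀ (by linarith) (by linarith)]
  nlinarith

theorem exists_of_feketeM_lt {n : ℕ} {δ : ℝ} (hδ : 0 < δ)
    (h : feketeM E q n < ENNReal.ofReal δ) :
    ∃ Z : Fin n → ℂ, (∀ j, Z j ∈ E) ∧ feketeProduct q Z = feketeSup E q n ∧
      ∀ ζ ∈ E, ‖wBlaschke q Z ζ‖ ≤ δ := by
  simp only [feketeM, iInf_lt_iff] at h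
  obtain ⟨Z, hZ, hlt⟩ := h
  refine ⟨Z, hZ.1, hZ.2, fun ζ hζ => ?_⟩
  have := (le_iSup₂ (f := fun z (_ : z ∈ E) => ‖wBlaschke q Z z‖ₑ) ζ hζ).trans hlt.le
  rwa [← ofReal_norm, ENNReal.ofReal_le_ofReal_iff hδ.le] at this

theorem FeketeDecay.exists_lt {C σ : ℝ} {N : ℕ} (h : FeketeDecay E q C σ N) {δ : ℝ}
    (hδ : 0 < δ) : ∃ n, N ≤ n ∧ feketeM E q n < ENNReal.ofReal δ := by
  obtain ⟨hC, hσ, hN, hM⟩ := h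
  have ht : Tendsto (fun n : ℕ => C * (n : ℝ) ^ (-σ)) atTop (𝓝 (C * 0)) :=
    ((tendsto_rpow_neg_atTop hσ).comp tendsto_natCast_atTop_atTop).const_mul C
  rw [mul_zero] at ht
  obtain ⟨n, hn, hlt⟩ := ((eventually_ge_atTop N).and (ht.eventually_lt_const hδ)).exists
  exact ⟨n, hn, (hM n hn).trans_lt ((ENNReal.ofReal_lt_ofReal_iff hδ).mpr hlt)⟩

theorem FeketeDecay.exists_small {C σ : ℝ} {N : ℕ} (h : FeketeDecay E q C σ N) {δ : ℝ}
    (hδ : 0 < δ) : ∃ (n : ℕ) (Z : Fin n → ℂ), (∀ j, Z j ∈ E) ∧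
      ∀ ζ ∈ E, ‖wBlaschke q Z ζ‖ ≤ δ := by
  obtain ⟨n, -, hn⟩ := h.exists_lt hδ
  obtain ⟨Z, hZ, -, hZδ⟩ := exists_of_feketeM_lt hδ hn
  exact ⟨n, Z, hZ, hZδ⟩

/-- If the weighted products decay polynomially, then small `ε` admit a maximizing tuple whose
weighted Blaschke product is small on `E` while its nodes stay well separated. -/
theorem FeketeDecay.exists_tuple (hE : IsRelClosed E) (hNB : IsNonBlaschke E)
    (hq : IsWeight E q) {C σ : ℝ} {N : ℕ} (h : FeketeDecay E q C σ N) :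
    ∃ ε₀ : ℝ, 0 < ε₀ ∧ ε₀ ≤ 1 ∧ ∀ ε : ℝ, 0 < ε → ε < ε₀ →
      ∃ (n : ℕ) (Z : Fin (n + 1) → ℂ) (τ : ℝ), (∀ j, Z j ∈ E) ∧ Function.Injective Z ∧ 0 < τ ∧
        (∀ j, τ ≤ ‖wBlaschke q (fun i => Z (j.succAbove i)) (Z j)‖) ∧
        (n + 1 : ℝ) * ε ≤ τ ∧ ∀ ζ ∈ E, ‖wBlaschke q Z ζ‖ ≤ ε ^ decayExponent σ := by
  obtain ⟨hC, hσ, hN, hM⟩ := id h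
  have hVpos := feketeSup_pos hE hNB hq
  have hVle := feketeSup_le_one (E := E) hE hq
  have hVtop : ∀ n, feketeSup E q n ≠ ∞ := fun n =>
    ne_top_of_le_ne_top ENNReal.one_ne_top (hVle n)
  set v : ℝ := (feketeSup E q N).toReal with hv
  have hv0 : 0 < v := ENNReal.toReal_pos (hVpos N).ne' (hVtop N)
  set D : ℝ := 2 * C ^ σ⁻¹ with hD
  have hD0 : 0 < D := by positivity
  have hN0 : (0 : ℝ) < N := by exact_mod_cast hN
  -- The bound v/N serves the case n = N, and D⁻² the case n > N, where it gives D √ε ≤ 1.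
  refine ⟨min 1 (min (v / N) (D⁻¹ ^ 2)), by positivity, min_le_left _ _, fun ε hε hlt => ?_⟩
  have hεN : (N : ℝ) * ε ≤ v := by
    have := hlt.le.trans ((min_le_right _ _).trans (min_le_left _ _))
    rwa [le_div_iff₀ hN0, mul_comm] at this
  have hεD : ε ≤ D⁻¹ ^ 2 := hlt.le.trans ((min_le_right _ _).trans (min_le_right _ _))
  set δ : ℝ := ε ^ decayExponent σ with hδdef
  have hδ : 0 < δ := Real.rpow_pos_of_pos hε _
  classical
  have hex := h.exists_lt hδ
  set n := Nat.find hex with hn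
  obtain ⟨hNn, hMn⟩ := Nat.find_spec hex
  suffices hτ : ∃ τ : ℝ, 0 < τ ∧ n * ε ≤ τ ∧
      ENNReal.ofReal τ * feketeSup E q (n - 1) ≤ feketeSup E q n by
    obtain ⟨τ, hτ0, hτε, hτV⟩ := hτ
    obtain ⟨m, hm⟩ : ∃ m, n = m + 1 := ⟨n - 1, by omega⟩
    rw [← hn, hm] at hMn
    rw [hm] at hτε hτV
    obtain ⟨Z, hZE, hZV, hZδ⟩ := exists_of_feketeM_lt hδ hMn
    have hZ0 : feketeProduct q Z ≠ 0 := by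
      rw [hZV]
      exact (hVpos _).ne'
    refine ⟨m, Z, τ, hZE, injective_of_feketeProduct_ne_zero hZ0, hτ0, fun j => ?_, ?_, hZδ⟩
    · have := le_enorm_wBlaschke_succAbove hZE (hτV.trans_eq hZV.symm) hZ0 (hVtop _) j
      rwa [← ofReal_norm, ENNReal.ofReal_le_ofReal_iff (norm_nonneg _)] at this
    · exact_mod_cast hτε
  rcases hNn.eq_or_lt with heq | hgt
  -- At n = N minimality says nothing about n - 1; V_N itself serves as τ because V_{N-1} ≤ 1.
  · rw [← hn] at heq
    refine ⟨v, hv0, by rwa [← heq], ?_⟩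
    rw [hv, ENNReal.ofReal_toReal (hVtop N), ← heq]
    exact mul_le_of_le_one_right zero_le (hVle _)
  · rw [← hn] at hgt
    have hmin := Nat.find_min hex (show n - 1 < n by omega)
    have hge : ENNReal.ofReal δ ≤ feketeM E q (n - 1) :=
      not_lt.mp fun hlt' => hmin ⟨by omega, hlt'⟩
    have hup := hM (n - 1) (by omega)
    have hstep := feketeSup_mul_feketeM_le (ne_top_of_le_ne_top ENNReal.ofReal_ne_top hup)
    rw [show n - 1 + 1 = n by omega] at hstep
    refine ⟨δ, hδ, ?_, ?_⟩
    · have hx1 : (1 : ℝ) ≤ ((n - 1 : ℕ) : ℝ) := by exact_mod_cast (by omega : 1 ≤ n - 1)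
      have hx0 : (0 : ℝ) < ((n - 1 : ℕ) : ℝ) := by linarith
      have hnx : (n : ℝ) ≤ 2 * ((n - 1 : ℕ) : ℝ) := by exact_mod_cast (by omega : n ≤ 2 * (n - 1))
      set x : ℝ := ((n - 1 : ℕ) : ℝ) with hx
      have hδx := hge.trans hup
      rw [ENNReal.ofReal_le_ofReal_iff (by positivity)] at hδx
      have hxσ : x ^ σ ≤ C * δ⁻¹ := by
        rw [Real.rpow_neg hx0.le, ← div_eq_mul_inv, le_div_iff₀ (by positivity)] at hδx
        rw [← div_eq_mul_inv, le_div_iff₀ hδ, mul_comm]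
        exact hδx
      have hxle : x ≤ C ^ σ⁻¹ * (δ⁻¹) ^ σ⁻¹ := by
        rw [← Real.mul_rpow hC.le (by positivity)]
        have := Real.rpow_le_rpow (by positivity) hxσ (inv_nonneg.mpr hσ.le)
        rwa [Real.rpow_rpow_inv hx0.le hσ.ne'] at this
      have hδσ : (δ⁻¹) ^ σ⁻¹ = ε ^ (-(decayExponent σ / σ)) := by
        rw [hδdef, ← Real.rpow_neg hε.le, ← Real.rpow_mul hε.le]
        congr 1
        ring
      have hhalf : D * ε ^ (1 / 2 : ℝ) ≤ 1 := by
        have h1 : ε ^ (1 / 2 : ℝ) ≤ D⁻¹ := by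
          rw [← Real.sqrt_eq_rpow]
          exact Real.sqrt_le_iff.mpr ⟨by positivity, hεD⟩
        calc D * ε ^ (1 / 2 : ℝ) ≤ D * D⁻¹ := by gcongr
          _ = 1 := mul_inv_cancel₀ hD0.ne'
      -- The exponent κ = σ/(2(1 + σ)) is the solution of 1 - κ/σ = 1/2 + κ; the spare √ε absorbs
      -- the constant D.
      have hsplit : ε ^ (-(decayExponent σ / σ)) * ε = ε ^ (1 / 2 : ℝ) * δ := by
        rw [hδdef, ← Real.rpow_add hε, ← Real.rpow_add_one hε.ne']
        congr 1
        unfold decayExponent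
        field_simp
        ring
      calc (n : ℝ) * ε ≤ 2 * (C ^ σ⁻¹ * (δ⁻¹) ^ σ⁻¹) * ε := by
            gcongr
            exact hnx.trans (by gcongr)
        _ = D * (ε ^ (-(decayExponent σ / σ)) * ε) := by
            rw [hδσ, hD]
            ring
        _ = D * ε ^ (1 / 2 : ℝ) * δ := by
            rw [hsplit]
            ring
        _ ≤ δ := mul_le_of_le_one_left hδ.le hhalf
    · rw [mul_comm]
      exact (mul_le_mul_right hge _).trans hstep

/-- A nonempty set of positive reals has an element that dominates every `min (σ / 2) 1`. -/
theorem exists_forall_min_half_le {S : Set ℝ} (hS : S.Nonempty) (hpos : ∀ σ ∈ S, 0 < σ) :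
    ∃ σ₀ ∈ S, ∀ σ ∈ S, min (σ / 2) 1 ≤ σ₀ := by
  by_contra! hcon
  obtain ⟨a, ha⟩ := hS
  have hlt : ∀ σ ∈ S, σ < 1 := fun σ hσ => by
    obtain ⟨t, -, h⟩ := hcon σ hσ
    exact h.trans_le (min_le_right _ _)
  have hb : BddAbove S := ⟨1, fun σ hσ => (hlt σ hσ).le⟩
  have hs : 0 < sSup S := (hpos a ha).trans_le (le_csSup hb ha)
  -- An element b beyond half the supremum would, by the negated claim, lie below t/2 for some t in
  -- S, forcing t above the supremum.
  obtain ⟨b, hbS, hb2⟩ := exists_lt_of_lt_csSup ⟨a, ha⟩ (half_lt_self hs)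
  obtain ⟨t, ht, h⟩ := hcon b hbS
  have h1 := le_csSup hb ht
  have h2 := h.trans_le (min_le_left _ _)
  linarith

end HardyStability

/-! ### The corollary -/

theorem corollary5p1 :
    ∃ (κ : ℝ → ℝ) (α : ℝ → ℝ) (K : ℝ≥0∞ → ℝ → ℝ),
      (∀ σ : ℝ, 0 < σ → 0 < κ σ) ∧
      (∀ R : ℝ, 0 < R → R < 1 → 0 < α R) ∧
      (∀ (p : ℝ≥0∞) (R : ℝ), 1 ≤ p → 0 < R → R < 1 → 0 < K p R) ∧
      ∀ (E : Set ℂ) (q : ℂ → ℂ),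
        HardyStability.IsRelClosed E → HardyStability.IsNonBlaschke E →
        HardyStability.IsWeight E q →
        ∃ ε₀ : ℝ, 0 < ε₀ ∧
          ∀ (C σ : ℝ) (N : ℕ), 0 < C → 0 < σ → 0 < N →
            (∀ n : ℕ, N ≤ n →
              HardyStability.feketeM E q n ≤ ENNReal.ofReal (C * (n : ℝ) ^ (-σ))) →
            ∀ (p : ℝ≥0∞) (R : ℝ), 1 ≤ p → 0 < R → R < 1 →
              ∀ ε : ℝ, 0 < ε → ε < ε₀ →
                HardyStability.blaschkeModulus E ε R q
                    ≤ HardyStability.stabilityModulus p E ε R ∧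
                HardyStability.stabilityModulus p E ε R
                    ≤ ENNReal.ofReal (K p R * ‖q 0‖ ^ (-(α R))) *
                      HardyStability.blaschkeModulus E (ε ^ κ σ) R q ^ α R := by
  -- κ is taken at min(σ/2, 1) instead of σ: the half allows for a supremum of rates that is not
  -- attained, the 1 for an unbounded set of rates.
  have hmin : ∀ σ : ℝ, 0 < σ → 0 < min (σ / 2) 1 := fun σ hσ => lt_min (half_pos hσ) one_pos
  refine ⟨fun σ => HardyStability.decayExponent (min (σ / 2) 1), HardyStability.exponent,
    fun _ R => HardyStability.stabilityConst R,
    fun σ hσ => HardyStability.decayExponent_pos (hmin σ hσ),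
    fun R h0 h1 => HardyStability.exponent_pos h0 h1,
    fun _ R _ h0 h1 => HardyStability.stabilityConst_pos h0 h1, fun E q hE hNB hq => ?_⟩
  rcases Set.eq_empty_or_nonempty {σ : ℝ | ∃ C N, HardyStability.FeketeDecay E q C σ N} with
    hS | hS
  · exact ⟨1, one_pos, fun C σ N hC hσ hN hM =>
      absurd (show σ ∈ {σ : ℝ | ∃ C N, HardyStability.FeketeDecay E q C σ N} from
        ⟨C, N, hC, hσ, hN, hM⟩) (by simp [hS])⟩
  -- The decay data are fixed before C, σ, N are introduced, so ε₀ depends only on E and q.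
  obtain ⟨σ₀, ⟨C₀, N₀, h₀⟩, hσ₀⟩ :=
    HardyStability.exists_forall_min_half_le hS fun σ ⟨_, _, h⟩ => h.2.1
  obtain ⟨ε₀, hε₀, hε₀1, htuple⟩ := h₀.exists_tuple hE hNB hq
  refine ⟨ε₀, hε₀, fun C σ N hC hσ hN hM p R hp h0 h1 ε hε hlt => ⟨?_, ?_⟩⟩
  · exact HardyStability.blaschkeModulus_le_stabilityModulus hE hq
      (fun δ hδ => h₀.exists_small hδ) hp hε
  · obtain ⟨n, Z, τ, hZE, hinj, hτ0, hτ, hετ, hδ⟩ := htuple ε hε hlt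
    refine HardyStability.stabilityModulus_le hE hq hp h0 h1 hZE hinj hτ0 hτ hετ fun ζ hζ =>
      (hδ ζ hζ).trans ?_
    exact Real.rpow_le_rpow_of_exponent_ge hε (hlt.trans_le hε₀1).le
      (HardyStability.decayExponent_mono (hmin σ hσ) (hσ₀ σ ⟨C, N, hC, hσ, hN, hM⟩))
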